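/- For a real number $P>0$ let $X_P$ be the complex vector space of locally square integrable, $P$-periodic functions $f:\mathbb R\to\mathbb C$ with zero mean value, $\int_0^P f\,dt=0$. Let $T_1,T_2,T_3$ be positive integers, put $X:=X_{T_1}+X_{T_2}+X_{T_3}$, and write $(a,b)$ and $(a,b,c)$ for greatest common divisors. Functions in $X$ are identified with their restrictions to the interval under consideration. Let $g:=(T_1,T_2,T_3)$ and $$T:=T_1+T_2+T_3-(T_1,T_2)-(T_2,T_3)-(T_3,T_1)+g.$$ Then $T$ is the critical length of $X$: $T>0$, $X$ is dense in $L^2(0,T')$ for all $0<T'<T$, and $X$ is not dense in $L^2(0,T')$ for any $T'>T$. The orthogonal complement of $X$ in $L^2(0,T)$ is spanned by a real-valued function $h_3$, unique up to a nonzero scalar, that may be chosen positive in a right neighborhood of $0$; and $h_3$ is constant on each of the intervals $((j-1)g,jg)$, $j=1,\dots,T/g$. (Statements about values of $h_3$ are understood almost everywhere.) With $h_3$ so chosen: (i) $h_3\ge 0$ on $(0,T)$. (ii) $h_3$ vanishes on at least one of the intervals $((j-1)g,jg)$, $1\le j\le T/g$, if and only if $$(T_1,T_2,T_3)<(T_i,T_j)<\min(T_i,T_j)\quad\text{for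 all } i\ne j.$$ In particular, if $(T_1,T_2,T_3)=1$, the condition in (ii) reads $1<(T_i,T_j)<\min(T_i,T_j)$ for all $i\ne j$. -/

import Mathlib

open MeasureTheory Set

noncomputable section

/-- `X_P`: the complex vector space of locally square integrable, `P`-periodic functions on the
line with zero mean value. -/
def periodicZeroMean (P : ℝ) : Submodule ℂ (ℝ → ℂ) where
  carrier := {f | (∀ K : Set ℝ, IsCompact K → MemLp f 2 (volume.restrict K)) ∧
    Function.Periodic f P ∧ ∫ t in (0 : ℝ)..P, f t = 0}
  zero_mem' := ⟨fun _ _ => MemLp.zero, fun _ => rfl, by simp⟩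
  add_mem' := by
    have key : ∀ f : ℝ → ℂ, (∀ K : Set ℝ, IsCompact K → MemLp f 2 (volume.restrict K)) →
        IntervalIntegrable f volume 0 P := by
      intro f hf
      have hI : IntegrableOn f (uIcc 0 P) volume := by
        haveI : IsFiniteMeasure (volume.restrict (uIcc (0 : ℝ) P)) :=
          ⟨by simpa using (isCompact_uIcc (a := (0 : ℝ)) (b := P)).measure_lt_top⟩
        exact (hf _ isCompact_uIcc).integrable (by norm_num)
      exact hI.intervalIntegrable
    rintro f g ⟨hf, hfp, hf0⟩ ⟨hg, hgp, hg0⟩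
    refine ⟨fun K hK => (hf K hK).add (hg K hK), hfp.add hgp, ?_⟩
    have h := intervalIntegral.integral_add (key f hf) (key g hg)
    rw [hf0, hg0, add_zero] at h
    exact h
  smul_mem' := by
    rintro c f ⟨hf, hfp, hf0⟩
    refine ⟨fun K hK => (hf K hK).const_smul c, hfp.smul c, ?_⟩
    have h := intervalIntegral.integral_smul (μ := volume) (a := 0) (b := P) c f
    rw [hf0, smul_zero] at h
    exact h

/-- `L²(0, L)` with complex values. -/
abbrev L2Interval (L : ℝ) : Type := Lp ℂ 2 (volume.restrict (Ioo (0 : ℝ) L))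

/-- The subspace of `L²(0, L)` formed by the restrictions to `(0, L)` of the functions in `X`. -/
def restrictL2 (X : Submodule ℂ (ℝ → ℂ)) (L : ℝ) : Submodule ℂ (L2Interval L) where
  carrier := {u | ∃ f ∈ X, u =ᵐ[volume.restrict (Ioo (0 : ℝ) L)] f}
  zero_mem' := ⟨0, X.zero_mem, Lp.coeFn_zero _ _ _⟩
  add_mem' := by
    rintro u v ⟨f, hf, huf⟩ ⟨g, hg, hvg⟩
    exact ⟨f + g, X.add_mem hf hg, (Lp.coeFn_add u v).trans (huf.add hvg)⟩
  smul_mem' := by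
    rintro c u ⟨f, hf, huf⟩
    exact ⟨c • f, X.smul_mem c hf, (Lp.coeFn_smul c u).trans (huf.const_smul c)⟩

/-- `L` is the critical length of `X`: the restrictions of `X` are dense in `L²(0, L')` for all
`0 < L' < L` and for no `L' > L`. -/
def IsCriticalLength (X : Submodule ℂ (ℝ → ℂ)) (L : ℝ) : Prop :=
  0 < L ∧
  (∀ L' : ℝ, 0 < L' → L' < L → Dense (restrictL2 X L' : Set (L2Interval L'))) ∧
  (∀ L' : ℝ, L < L' → ¬ Dense (restrictL2 X L' : Set (L2Interval L')))

/-- The real-valued function `h` spans the orthogonal complement of `X` in `L²(0, L)`, and it is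
positive (almost everywhere) in a right neighbourhood of `0`. -/
def IsNormalizedGenerator (X : Submodule ℂ (ℝ → ℂ)) (L : ℝ) (h : ℝ → ℝ) : Prop :=
  (∃ hm : MemLp (fun t => (h t : ℂ)) 2 (volume.restrict (Ioo (0 : ℝ) L)),
    (restrictL2 X L)ᗮ = Submodule.span ℂ {hm.toLp (fun t => (h t : ℂ))}) ∧
  ∃ δ : ℝ, 0 < δ ∧ ∀ᵐ t ∂volume.restrict (Ioo (0 : ℝ) δ), 0 < h t

/-- `X_{T₁} + X_{T₂} + X_{T₃}` for three integer periods. -/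
def periodSum (T : Fin 3 → ℕ) : Submodule ℂ (ℝ → ℂ) := ⨆ i, periodicZeroMean (T i)

/-- The greatest common divisor of the three periods. -/
def gcdThree (T : Fin 3 → ℕ) : ℕ := Nat.gcd (Nat.gcd (T 0) (T 1)) (T 2)

/-- `T₁ + T₂ + T₃ - (T₁,T₂) - (T₂,T₃) - (T₃,T₁) + (T₁,T₂,T₃)`, as a real number. -/
def criticalLength (T : Fin 3 → ℕ) : ℝ :=
  T 0 + T 1 + T 2 - Nat.gcd (T 0) (T 1) - Nat.gcd (T 1) (T 2) - Nat.gcd (T 2) (T 0) + gcdThree T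

/-- The open interval `((j - 1) g, j g)`, where `g` is the greatest common divisor of the
periods. -/
def unitInterval3 (T : Fin 3 → ℕ) (j : ℕ) : Set ℝ :=
  Ioo (((j : ℝ) - 1) * gcdThree T) ((j : ℝ) * gcdThree T)

end

/-!
Write `g` for the gcd of the three periods and `a, b, c` for the periods divided by `g`. Split a
function `U` supported in `(0, L)` into the sequences `n ↦ U (s + n g)`, `0 < s < g`, and let `A_s`
be the polynomial with these coefficients. Testing `U` against the functions of `X_{gm}` of the
form `ζ ^ n * φ s` at `s + n g`, with `ζ ^ m = 1` and `φ` an indicator function (minus its mean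
value if `ζ = 1`), shows that orthogonality to `X_{gm}` forces, for almost all `s`, `A_s(ζ) = 0` for
all `m`-th roots of unity `ζ ≠ 1`, and forces `A_s(1)` not to depend on `s`.

Let `Q` be the monic polynomial whose roots, all simple, are the numbers `ζ ≠ 1` with `ζ ^ a = 1`,
`ζ ^ b = 1` or `ζ ^ c = 1`. By inclusion and exclusion `deg Q + 1 = T / g`, where `T` is the critical
length. If `L ≤ T`, then `A_s` has degree at most `deg Q`, so `A_s = κ Q` with `κ` independent of `s`,
since `Q(1) ≠ 0` (`exists_ae_eq_const_mul_coeff`). If `L < T`, then moreover `A_s` has a vanishing top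
coefficient for `s` in a set of positive measure, so `κ = 0`. Conversely `Q` is divisible by
`1 + z + ⋯ + z ^ (m - 1)` for `m = a, b, c`, so the step function with the coefficients of `Q` is
orthogonal to `X` (`integral_conj_mul_coeff_eq_zero`). Hence this step function, `gapStep`, spans the
orthogonal complement of `X` in `L²(0, T)`, and `X` is not dense in any `L²(0, L)` with `L > T`.

The remaining statements concern the coefficients of `Q`. With `[n]_d = ∑_{i < n / d} z ^ (d i)` one
has `Q = [a]_(a,b) [b]_(b,c) [c]_(c,a)`, because the three gcds are pairwise coprime; so the
coefficients are nonnegative. If the three gcds exceed `1`, then the coefficient of `z` is zero. If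
one of them, say `(a, b)`, is `1`, then `[a]_1` has no gaps, and multiplying by `[c]_(c,a)` and then
by `[b]_(b,c)` creates none, since the steps `(c, a) ≤ a` and `(b, c) ≤ c` are short enough
(`gapPoly_coeff_ne_zero`). Finally, if the three gcds exceed `1`, each of them is smaller than the
two corresponding periods: `(a, b) = a` would imply `(c, a) = (a, b, c) = 1`.
-/

noncomputable section

namespace CriticalLength

/-! ### The polynomial `Q` and its roots -/

section

open Polynomial

/-- The polynomial `[n]_d = 1 + X ^ d + X ^ (2 d) + ⋯ + X ^ (n - d)`; it is used for `d ∣ n`, when it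
is `(X ^ n - 1) / (X ^ d - 1)`. -/
def geomStep (d n : ℕ) : ℕ[X] := ∑ i ∈ Finset.range (n / d), X ^ (d * i)

/-- The polynomial `Q` of three coprime periods. It is defined with coefficients in `ℕ`, so that their
nonnegativity is automatic. -/
def gapPoly (a b c : ℕ) : ℕ[X] :=
  geomStep (a.gcd b) a * geomStep (b.gcd c) b * geomStep (c.gcd a) c

lemma gapPoly_rotate (a b c : ℕ) : gapPoly b c a = gapPoly a b c := by
  unfold gapPoly; ring

lemma coeff_geomStep_mul {d n k : ℕ} (hd : 0 < d) (hk : k < n / d) :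
    (geomStep d n).coeff (d * k) = 1 := by
  simp only [geomStep, finsetSum_coeff, coeff_X_pow]
  rw [Finset.sum_eq_single k]
  · simp
  · intro i _ hi
    rw [if_neg]
    intro h
    exact hi (Nat.eq_of_mul_eq_mul_left hd h).symm
  · intro h
    exact absurd (Finset.mem_range.2 hk) h

lemma coeff_geomStep_of_not_dvd {d n m : ℕ} (h : ¬ d ∣ m) : (geomStep d n).coeff m = 0 := by
  simp only [geomStep, finsetSum_coeff, coeff_X_pow]
  refine Finset.sum_eq_zero fun i _ => if_neg ?_
  rintro rfl
  exact h (dvd_mul_right d i)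

lemma natDegree_geomStep_le (d n : ℕ) : (geomStep d n).natDegree ≤ n - d := by
  refine natDegree_sum_le_of_forall_le _ _ fun i hi => (natDegree_X_pow_le _).trans ?_
  have h : i + 1 ≤ n / d := Finset.mem_range.1 hi
  have h2 : d * (i + 1) ≤ n := (Nat.mul_le_mul_left d h).trans (Nat.mul_div_le n d)
  rw [mul_add, mul_one] at h2
  omega

lemma coeff_geomStep_top {d n : ℕ} (hn : 0 < n) (hdn : d ∣ n) :
    (geomStep d n).coeff (n - d) = 1 := by
  obtain ⟨k, rfl⟩ := hdn
  have hd : 0 < d := Nat.pos_of_mul_pos_right hn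
  have hk : 0 < k := Nat.pos_of_mul_pos_left hn
  have : d * k - d = d * (k - 1) := by rw [Nat.mul_sub, mul_one]
  rw [this]
  refine coeff_geomStep_mul hd ?_
  rw [Nat.mul_div_cancel_left _ hd]; omega

lemma monic_geomStep {d n : ℕ} (hn : 0 < n) (hdn : d ∣ n) : (geomStep d n).Monic :=
  monic_of_natDegree_le_of_coeff_eq_one _ (natDegree_geomStep_le d n) (coeff_geomStep_top hn hdn)

lemma natDegree_geomStep {d n : ℕ} (hn : 0 < n) (hdn : d ∣ n) :
    (geomStep d n).natDegree = n - d :=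
  le_antisymm (natDegree_geomStep_le d n)
    (le_natDegree_of_ne_zero (by rw [coeff_geomStep_top hn hdn]; exact one_ne_zero))

lemma geomStep_eval_zero_of {d n : ℕ} (hdn : d ∣ n) {ζ : ℂ} (hn : ζ ^ n = 1) (hd : ζ ^ d ≠ 1) :
    eval₂ (Nat.castRingHom ℂ) ζ (geomStep d n) = 0 := by
  have h := geom_sum_mul (ζ ^ d) (n / d)
  rw [← pow_mul, Nat.mul_div_cancel' hdn, hn, sub_self] at h
  have h2 := (mul_eq_zero.1 h).resolve_right (sub_ne_zero.2 hd)
  simpa [geomStep, eval₂_finsetSum, pow_mul, eval₂_pow] using h2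

section

variable {a b c : ℕ}

lemma monic_gapPoly (ha : 0 < a) (hb : 0 < b) (hc : 0 < c) : (gapPoly a b c).Monic :=
  ((monic_geomStep ha (Nat.gcd_dvd_left a b)).mul (monic_geomStep hb (Nat.gcd_dvd_left b c))).mul
    (monic_geomStep hc (Nat.gcd_dvd_left c a))

lemma natDegree_gapPoly (ha : 0 < a) (hb : 0 < b) (hc : 0 < c) :
    (gapPoly a b c).natDegree = (a - a.gcd b) + (b - b.gcd c) + (c - c.gcd a) := by
  have h1 := monic_geomStep ha (Nat.gcd_dvd_left a b)
  have h2 := monic_geomStep hb (Nat.gcd_dvd_left b c)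
  have h3 := monic_geomStep hc (Nat.gcd_dvd_left c a)
  rw [gapPoly, (h1.mul h2).natDegree_mul h3, h1.natDegree_mul h2,
    natDegree_geomStep ha (Nat.gcd_dvd_left a b), natDegree_geomStep hb (Nat.gcd_dvd_left b c),
    natDegree_geomStep hc (Nat.gcd_dvd_left c a)]

/-- Let `ζ ^ a = 1`. If the factor `[a]_(a,b)` does not vanish at `ζ`, then
`ζ ^ (a, b) = 1`; if `[b]_(b,c)` does not vanish either, then also `ζ ^ (b, c) = 1`, and `ζ = 1`
because the two gcds are coprime. -/
lemma gapPoly_eval_eq_zero (hg : (a.gcd b).gcd c = 1) {ζ : ℂ} (hζ : ζ ≠ 1) (h : ζ ^ a = 1) :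
    eval₂ (Nat.castRingHom ℂ) ζ (gapPoly a b c) = 0 := by
  rw [gapPoly, eval₂_mul, eval₂_mul]
  by_cases hd : ζ ^ (a.gcd b) = 1
  · have hb : ζ ^ b = 1 := by
      obtain ⟨k, hk⟩ := Nat.gcd_dvd_right a b
      rw [hk, pow_mul, hd, one_pow]
    rw [geomStep_eval_zero_of (Nat.gcd_dvd_left b c) hb, mul_zero, zero_mul]
    intro he
    apply hζ
    have h1 : (a.gcd b).gcd (b.gcd c) = 1 := by
      apply Nat.eq_one_of_dvd_one
      rw [← hg]
      exact Nat.dvd_gcd (Nat.gcd_dvd_left _ _)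
        ((Nat.gcd_dvd_right _ _).trans (Nat.gcd_dvd_right _ _))
    have h2 := pow_gcd_eq_one.2 ⟨hd, he⟩
    rwa [h1, pow_one] at h2
  · rw [geomStep_eval_zero_of (Nat.gcd_dvd_left a b) h hd, zero_mul, zero_mul]

lemma gcd_rotate (a b c : ℕ) : (b.gcd c).gcd a = (a.gcd b).gcd c := by
  rw [Nat.gcd_comm, Nat.gcd_assoc]

lemma gapPoly_eval_eq_zero_of_or (hg : (a.gcd b).gcd c = 1) {ζ : ℂ} (hζ : ζ ≠ 1)
    (h : ζ ^ a = 1 ∨ ζ ^ b = 1 ∨ ζ ^ c = 1) :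
    eval₂ (Nat.castRingHom ℂ) ζ (gapPoly a b c) = 0 := by
  rcases h with h | h | h
  · exact gapPoly_eval_eq_zero hg hζ h
  · rw [← gapPoly_rotate]
    exact gapPoly_eval_eq_zero (by rw [gcd_rotate, hg]) hζ h
  · rw [← gapPoly_rotate, ← gapPoly_rotate]
    exact gapPoly_eval_eq_zero (by rw [gcd_rotate, gcd_rotate, hg]) hζ h

lemma card_nthRoots (n : ℕ) (hn : 0 < n) : (nthRootsFinset n (1 : ℂ)).card = n :=
  (Complex.isPrimitiveRoot_exp n hn.ne').card_nthRootsFinset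

lemma nthRoots_inter {a b : ℕ} (ha : 0 < a) (hb : 0 < b) :
    nthRootsFinset a (1 : ℂ) ∩ nthRootsFinset b 1 = nthRootsFinset (a.gcd b) 1 := by
  ext ζ
  rw [Finset.mem_inter, mem_nthRootsFinset ha, mem_nthRootsFinset hb,
    mem_nthRootsFinset (Nat.gcd_pos_of_pos_left b ha)]
  exact pow_gcd_eq_one.symm

/-- The set of roots of `Q`: the complex numbers other than `1` that are `a`-th, `b`-th or `c`-th
roots of unity. -/
def nontrivialRoots (a b c : ℕ) : Finset ℂ :=
  ((nthRootsFinset a 1 ∪ nthRootsFinset b 1) ∪ nthRootsFinset c 1).erase 1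

lemma mem_nontrivialRoots (ha : 0 < a) (hb : 0 < b) (hc : 0 < c) {ζ : ℂ} :
    ζ ∈ nontrivialRoots a b c ↔ ζ ≠ 1 ∧ (ζ ^ a = 1 ∨ ζ ^ b = 1 ∨ ζ ^ c = 1) := by
  rw [nontrivialRoots, Finset.mem_erase, Finset.mem_union, Finset.mem_union,
    mem_nthRootsFinset ha, mem_nthRootsFinset hb, mem_nthRootsFinset hc, or_assoc]

lemma card_nontrivialRoots (hg : (a.gcd b).gcd c = 1) (ha : 0 < a) (hb : 0 < b) (hc : 0 < c) :
    (nontrivialRoots a b c).card = (gapPoly a b c).natDegree := by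
  have h1 := Finset.card_union_add_card_inter (nthRootsFinset a (1 : ℂ)) (nthRootsFinset b 1)
  have h2 := Finset.card_union_add_card_inter
    (nthRootsFinset a (1 : ℂ) ∪ nthRootsFinset b 1) (nthRootsFinset c 1)
  have h3 := Finset.card_union_add_card_inter
    (nthRootsFinset (a.gcd c) (1 : ℂ)) (nthRootsFinset (b.gcd c) 1)
  have hac := Nat.gcd_pos_of_pos_left c ha
  have hbc := Nat.gcd_pos_of_pos_left c hb
  have hab := Nat.gcd_pos_of_pos_left b ha
  have hg' : (a.gcd c).gcd (b.gcd c) = 1 := by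
    rw [← hg]
    apply Nat.dvd_antisymm
    · exact Nat.dvd_gcd (Nat.gcd_dvd_gcd_of_dvd_left _ (Nat.gcd_dvd_left a c) |>.trans
        (Nat.gcd_dvd_gcd_of_dvd_right _ (Nat.gcd_dvd_left b c)))
        ((Nat.gcd_dvd_left _ _).trans (Nat.gcd_dvd_right _ _))
    · exact Nat.dvd_gcd
        (Nat.dvd_gcd ((Nat.gcd_dvd_left _ _).trans (Nat.gcd_dvd_left _ _)) (Nat.gcd_dvd_right _ _))
        (Nat.dvd_gcd ((Nat.gcd_dvd_left _ _).trans (Nat.gcd_dvd_right _ _)) (Nat.gcd_dvd_right _ _))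
  rw [nthRoots_inter ha hb, card_nthRoots a ha, card_nthRoots b hb, card_nthRoots _ hab] at h1
  rw [Finset.union_inter_distrib_right, nthRoots_inter ha hc, nthRoots_inter hb hc,
    card_nthRoots c hc] at h2
  rw [nthRoots_inter hac hbc, card_nthRoots _ hac, card_nthRoots _ hbc, hg',
    card_nthRoots 1 one_pos] at h3
  have h4 := Nat.le_of_dvd ha (Nat.gcd_dvd_left a b)
  have h5 := Nat.le_of_dvd hb (Nat.gcd_dvd_left b c)
  have h6 := Nat.le_of_dvd hc (Nat.gcd_dvd_left c a)
  have h7 := Nat.gcd_comm a c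
  rw [nontrivialRoots, Finset.card_erase_of_mem
    (by simp [mem_nthRootsFinset ha]), natDegree_gapPoly ha hb hc]
  omega

/-- A polynomial of degree at most `deg Q` that vanishes at the `deg Q` roots of `Q` is a multiple of
`Q`: subtracting the multiple with the same coefficient at `deg Q` leaves too many roots. -/
lemma eq_C_mul_gapPoly (hg : (a.gcd b).gcd c = 1) (ha : 0 < a) (hb : 0 < b) (hc : 0 < c)
    {A : ℂ[X]} (hA : A.natDegree ≤ (gapPoly a b c).natDegree)
    (h0 : ∀ ζ ∈ nontrivialRoots a b c, A.eval ζ = 0) :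
    A = C (A.coeff (gapPoly a b c).natDegree) * (gapPoly a b c).map (Nat.castRingHom ℂ) := by
  have hm := (monic_gapPoly ha hb hc).map (Nat.castRingHom ℂ)
  have hd : ((gapPoly a b c).map (Nat.castRingHom ℂ)).natDegree = (gapPoly a b c).natDegree :=
    (monic_gapPoly ha hb hc).natDegree_map _
  rw [← sub_eq_zero]
  refine eq_zero_of_degree_lt_of_eval_finset_eq_zero (nontrivialRoots a b c) ?_ ?_
  · rw [card_nontrivialRoots hg ha hb hc, degree_lt_iff_coeff_zero]
    intro m hm'
    rw [coeff_sub, coeff_C_mul]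
    rcases hm'.eq_or_lt with rfl | hlt
    · have : ((gapPoly a b c).map (Nat.castRingHom ℂ)).coeff (gapPoly a b c).natDegree = 1 := by
        rw [← hd]; exact hm.coeff_natDegree
      rw [this, mul_one, sub_self]
    · rw [coeff_eq_zero_of_natDegree_lt (hA.trans_lt hlt),
        coeff_eq_zero_of_natDegree_lt (hd.trans_lt hlt), mul_zero, sub_zero]
  · intro ζ hζ
    have h := (mem_nontrivialRoots ha hb hc).1 hζ
    rw [eval_sub, eval_mul, eval_map, gapPoly_eval_eq_zero_of_or hg h.1 h.2, mul_zero, h0 ζ hζ,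
      sub_zero]

/-- The remainder of `Q` modulo `1 + X + ⋯ + X ^ (m - 1)` has degree less than `m - 1` and vanishes at
the `m - 1` nontrivial `m`-th roots of unity. -/
lemma geom_dvd_gapPoly (hg : (a.gcd b).gcd c = 1) {m : ℕ} (hm : 0 < m)
    (h : m = a ∨ m = b ∨ m = c) :
    (∑ i ∈ Finset.range m, X ^ i : ℂ[X]) ∣ (gapPoly a b c).map (Nat.castRingHom ℂ) := by
  have hgs : (∑ i ∈ Finset.range m, X ^ i : ℂ[X]) = (geomStep 1 m).map (Nat.castRingHom ℂ) := by
    simp [geomStep, Polynomial.map_sum]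
  have hmon := (monic_geomStep hm (one_dvd m)).map (Nat.castRingHom ℂ)
  have hdeg : ((geomStep 1 m).map (Nat.castRingHom ℂ)).natDegree = m - 1 := by
    rw [(monic_geomStep hm (one_dvd m)).natDegree_map, natDegree_geomStep hm (one_dvd m)]
  rw [hgs, ← modByMonic_eq_zero_iff_dvd hmon]
  refine eq_zero_of_degree_lt_of_eval_finset_eq_zero ((nthRootsFinset m (1 : ℂ)).erase 1) ?_ ?_
  · rw [Finset.card_erase_of_mem (by simp [mem_nthRootsFinset hm]), card_nthRoots m hm]
    refine (degree_modByMonic_lt _ hmon).trans_le ?_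
    rw [degree_eq_natDegree hmon.ne_zero, hdeg]
  · intro ζ hζ
    rw [Finset.mem_erase, mem_nthRootsFinset hm] at hζ
    have h1 : eval ζ ((geomStep 1 m).map (Nat.castRingHom ℂ)) = 0 := by
      rw [eval_map]
      exact geomStep_eval_zero_of (one_dvd m) hζ.2 (by simpa using hζ.1)
    have h2 : eval ζ ((gapPoly a b c).map (Nat.castRingHom ℂ)) = 0 := by
      rw [eval_map]
      refine gapPoly_eval_eq_zero_of_or hg hζ.1 ?_
      rcases h with h | h | h <;> simp [← h, hζ.2]
    rw [modByMonic_eq_sub_mul_div, eval_sub, eval_mul, h1, h2, zero_mul, sub_zero]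

/-- Summing the coefficients of `Q` against an `m`-periodic sequence of zero mean gives zero. -/
lemma sum_coeff_mul_periodic (hg : (a.gcd b).gcd c = 1) {m : ℕ} (hm : 0 < m)
    (h : m = a ∨ m = b ∨ m = c) {F : ℕ → ℂ} (hF : Function.Periodic F m)
    (hF0 : ∑ i ∈ Finset.range m, F i = 0) (N : ℕ) (hN : (gapPoly a b c).natDegree < N) :
    ∑ n ∈ Finset.range N, ((gapPoly a b c).coeff n : ℂ) * F n = 0 := by
  obtain ⟨R, hR⟩ := geom_dvd_gapPoly hg hm h
  -- the linear functional sending `X ^ n` to `F n`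
  let Λ : ℂ[X] →ₗ[ℂ] ℂ := Polynomial.lsum fun n => LinearMap.mulRight ℂ (F n)
  have hmono : ∀ n (r : ℂ), Λ (monomial n r) = r * F n := by
    intro n r
    simp [Λ, Polynomial.lsum_apply, sum_monomial_index]
  -- every `m` consecutive terms of `F` add up to zero
  have hshift : ∀ k, ∑ i ∈ Finset.range m, F (i + k) = 0 := by
    intro k
    induction k with
    | zero => simpa using hF0
    | succ k ih =>
      have h1 := Finset.sum_range_succ (fun i => F (i + k)) m
      rw [Finset.sum_range_succ', ih, add_comm m k, hF k, zero_add, zero_add] at h1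
      have h2 : ∀ i, i + (k + 1) = i + 1 + k := fun i => by omega
      simp only [h2]
      simpa using h1
  have hzero : ∀ R : ℂ[X], Λ ((∑ i ∈ Finset.range m, X ^ i) * R) = 0 := by
    intro R
    induction R using Polynomial.induction_on' with
    | add p q hp hq => rw [mul_add, map_add, hp, hq, add_zero]
    | monomial k r =>
      rw [Finset.sum_mul, map_sum]
      simp only [X_pow_mul_monomial, hmono]
      rw [← Finset.mul_sum]
      simp only [add_comm k, hshift, mul_zero]
  have hQ := as_sum_range' ((gapPoly a b c).map (Nat.castRingHom ℂ)) N
    (natDegree_map_le.trans_lt hN)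
  have h3 := hzero R
  rw [← hR, hQ, map_sum] at h3
  simpa [hmono] using h3

end

/-! ### Vanishing coefficients of `Q` -/

lemma coeff_mul_ne_zero {p q : ℕ[X]} {i j n : ℕ} (h : i + j = n) (hp : p.coeff i ≠ 0)
    (hq : q.coeff j ≠ 0) : (p * q).coeff n ≠ 0 := by
  rw [coeff_mul]
  intro h0
  have := (Finset.sum_eq_zero_iff.1 h0) (i, j) (by simpa using h)
  exact mul_ne_zero hp hq this

/-- If `p` has no gaps up to degree `D` and the translates by multiples of `e` of `{0, …, D}` leave no
gap, then `p * [n]_e` has no gaps. -/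
lemma coeff_mul_geomStep_ne_zero {p : ℕ[X]} {D e n : ℕ} (hp : ∀ i ≤ D, p.coeff i ≠ 0)
    (he : 0 < e) (hen : e ∣ n) (hn : 0 < n) (heD : e ≤ D + 1) :
    ∀ i ≤ D + (n - e), (p * geomStep e n).coeff i ≠ 0 := by
  obtain ⟨k, rfl⟩ := hen
  have hk : 0 < k := Nat.pos_of_mul_pos_left hn
  intro i hi
  have key : ∀ j < k, e * j ≤ i → i ≤ D + e * j →
      (p * geomStep e (e * k)).coeff i ≠ 0 := by
    intro j hj h1 h2
    refine coeff_mul_ne_zero (Nat.sub_add_cancel h1) (hp _ (by omega)) ?_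
    rw [coeff_geomStep_mul he (by rwa [Nat.mul_div_cancel_left _ he])]
    exact one_ne_zero
  by_cases hlt : i / e < k
  · have h3 := Nat.div_add_mod i e
    have h4 := Nat.mod_lt i he
    exact key (i / e) hlt (by omega) (by omega)
  · have h3 : e * k ≤ i := (Nat.mul_le_mul_left e (not_lt.1 hlt)).trans (Nat.mul_div_le i e)
    have h5 : e * (k - 1) = e * k - e := by rw [Nat.mul_sub, mul_one]
    exact key (k - 1) (by omega) (by omega) (by omega)

/-- If one of the three gcds is `1`, then `Q` has no gaps. The order of the factors matters: after
`[a]_1 [c]_(c,a)` the step `(b, c) ≤ c` of the last factor is short enough. -/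
lemma gapPoly_coeff_ne_zero {a b c : ℕ} (ha : 0 < a) (hb : 0 < b) (hc : 0 < c)
    (hd : a.gcd b = 1) {i : ℕ} (hi : i ≤ (gapPoly a b c).natDegree) :
    (gapPoly a b c).coeff i ≠ 0 := by
  have h4 := Nat.le_of_dvd hb (Nat.gcd_dvd_left b c)
  have h5 := Nat.le_of_dvd hc (Nat.gcd_dvd_right b c)
  have h6 := Nat.le_of_dvd hc (Nat.gcd_dvd_left c a)
  have h7 := Nat.le_of_dvd ha (Nat.gcd_dvd_right c a)
  rw [natDegree_gapPoly ha hb hc] at hi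
  rw [gapPoly, mul_right_comm]
  rw [hd] at hi ⊢
  refine coeff_mul_geomStep_ne_zero (D := a - 1 + (c - c.gcd a)) ?_
    (Nat.gcd_pos_of_pos_left c hb) (Nat.gcd_dvd_left b c) hb (by omega) i (by omega)
  refine coeff_mul_geomStep_ne_zero ?_ (Nat.gcd_pos_of_pos_left a hc) (Nat.gcd_dvd_left c a) hc
    (by omega)
  intro i hi
  have h := coeff_geomStep_mul (d := 1) (n := a) (k := i) one_pos (by rw [Nat.div_one]; omega)
  rw [one_mul] at h
  rw [h]; exact one_ne_zero

lemma gapPoly_coeff_one {a b c : ℕ} (h1 : a.gcd b ≠ 1) (h2 : b.gcd c ≠ 1) (h3 : c.gcd a ≠ 1) :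
    (gapPoly a b c).coeff 1 = 0 := by
  have h : ∀ d n, d ≠ 1 → (geomStep d n).coeff 1 = 0 := fun d n hd =>
    coeff_geomStep_of_not_dvd fun h => hd (Nat.dvd_one.1 h)
  have hmul : ∀ p q : ℕ[X], p.coeff 1 = 0 → q.coeff 1 = 0 → (p * q).coeff 1 = 0 := by
    intro p q hp hq
    rw [mul_coeff_one, hp, hq, mul_zero, zero_mul, add_zero]
  exact hmul _ _ (hmul _ _ (h _ _ h1) (h _ _ h2)) (h _ _ h3)

lemma gapPoly_coeff_zero {a b c : ℕ} (ha : 0 < a) (hb : 0 < b) (hc : 0 < c) :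
    (gapPoly a b c).coeff 0 = 1 := by
  have h : ∀ d n, 0 < n → d ∣ n → (geomStep d n).coeff 0 = 1 := fun d n hn hdn => by
    have hd := Nat.pos_of_dvd_of_pos hdn hn
    have := coeff_geomStep_mul (k := 0) hd (Nat.div_pos (Nat.le_of_dvd hn hdn) hd)
    rwa [mul_zero] at this
  rw [gapPoly, mul_coeff_zero, mul_coeff_zero, h _ _ ha (Nat.gcd_dvd_left a b),
    h _ _ hb (Nat.gcd_dvd_left b c), h _ _ hc (Nat.gcd_dvd_left c a), one_mul, one_mul]

/-- If `(a, b) = a`, then `(c, a) = (a, b, c) = 1`. -/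
lemma gcd_lt_of_ne_one {a b c : ℕ} (hg : (a.gcd b).gcd c = 1) (ha : 0 < a)
    (h3 : c.gcd a ≠ 1) : a.gcd b < a := by
  refine lt_of_le_of_ne (Nat.le_of_dvd ha (Nat.gcd_dvd_left a b)) fun h => h3 ?_
  rw [h] at hg
  rwa [Nat.gcd_comm]

lemma exists_coeff_eq_zero_iff {a b c : ℕ} (hg : (a.gcd b).gcd c = 1) (ha : 0 < a) (hb : 0 < b)
    (hc : 0 < c) :
    (∃ i ≤ (gapPoly a b c).natDegree, (gapPoly a b c).coeff i = 0) ↔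
      a.gcd b ≠ 1 ∧ b.gcd c ≠ 1 ∧ c.gcd a ≠ 1 := by
  constructor
  · rintro ⟨i, hi, h0⟩
    refine ⟨fun h => ?_, fun h => ?_, fun h => ?_⟩
    · exact gapPoly_coeff_ne_zero ha hb hc h hi h0
    · rw [← gapPoly_rotate] at hi h0
      exact gapPoly_coeff_ne_zero hb hc ha h hi h0
    · rw [← gapPoly_rotate, ← gapPoly_rotate] at hi h0
      exact gapPoly_coeff_ne_zero hc ha hb h hi h0
  · rintro ⟨h1, h2, h3⟩
    refine ⟨1, ?_, gapPoly_coeff_one h1 h2 h3⟩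
    rw [natDegree_gapPoly ha hb hc]
    have := gcd_lt_of_ne_one hg ha h3
    omega

end

/-! ### Periodic functions and periodized sequences -/

section

open scoped ComplexConjugate

variable {g : ℝ}

lemma integrableOn_comp_add_mul {F : ℝ → ℂ} {N : ℕ} (hg : 0 < g)
    (hF : IntegrableOn F (Ioo 0 (N * g))) {n : ℕ} (hn : n < N) :
    IntegrableOn (fun s => F (s + n * g)) (Ioo 0 g) := by
  have hmp := measurePreserving_add_right (volume : Measure ℝ) (n * g)
  have hemb := (MeasurableEquiv.addRight ((n : ℝ) * g)).measurableEmbedding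
  have hn' : (n : ℝ) + 1 ≤ N := by exact_mod_cast hn
  have hsub : Ioo (n * g) (n * g + g) ⊆ Ioo (0 : ℝ) (N * g) := by
    apply Ioo_subset_Ioo
    · positivity
    · nlinarith
  have h := (hmp.integrableOn_comp_preimage hemb).2 (hF.mono_set hsub)
  have hpre : (fun x : ℝ => x + n * g) ⁻¹' Ioo (n * g) (n * g + g) = Ioo 0 g := by
    ext x; simp [add_comm]
  rw [hpre] at h
  exact h

/-- An integral over `(0, N g)` is the integral over `(0, g)` of the sum of `N` translates. -/
lemma setIntegral_Ioo_eq_sum {F : ℝ → ℂ} {N : ℕ} (hg : 0 < g)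
    (hF : IntegrableOn F (Ioo 0 (N * g))) :
    ∫ t in Ioo 0 (N * g), F t = ∑ n ∈ Finset.range N, ∫ s in Ioo 0 g, F (s + n * g) := by
  have hint : ∀ n < N, IntervalIntegrable F volume ((n : ℝ) * g) (((n + 1 : ℕ) : ℝ) * g) := by
    intro n hn
    have hn' : (n : ℝ) + 1 ≤ N := by exact_mod_cast hn
    rw [intervalIntegrable_iff_integrableOn_Ioo_of_le (by push_cast; nlinarith)]
    refine hF.mono_set (Ioo_subset_Ioo (by positivity) ?_)
    push_cast; nlinarith
  have h := intervalIntegral.sum_integral_adjacent_intervals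
    (a := fun n : ℕ => (n : ℝ) * g) hint
  rw [← integral_Ioc_eq_integral_Ioo, ← intervalIntegral.integral_of_le (by positivity)]
  simp only [Nat.cast_zero, zero_mul] at h
  rw [← h]
  refine Finset.sum_congr rfl fun n _ => ?_
  rw [← integral_Ioc_eq_integral_Ioo, ← intervalIntegral.integral_of_le hg.le,
    intervalIntegral.integral_comp_add_right, zero_add]
  congr 1
  push_cast; ring

/-- The test function equal to `ζ ^ n * φ (t - n g)` on `[n g, (n + 1) g)` for all integers `n`; it is
`m g`-periodic if `ζ ^ m = 1`. -/
def testFun (g : ℝ) (ζ : ℂ) (φ : ℝ → ℝ) (t : ℝ) : ℂ :=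
  ζ ^ ⌊t / g⌋ * φ (t - ⌊t / g⌋ * g)

lemma floor_add_mul_div (hg : 0 < g) (n : ℕ) {s : ℝ} (hs : s ∈ Ioo 0 g) :
    ⌊(s + n * g) / g⌋₊ = n := by
  have h : (s + n * g) / g = s / g + n := by field_simp
  rw [h, Nat.floor_add_natCast (div_nonneg hs.1.le hg.le),
    Nat.floor_eq_zero.2 ((div_lt_one hg).2 hs.2), zero_add]

lemma testFun_add_mul (hg : 0 < g) (ζ : ℂ) (φ : ℝ → ℝ) (n : ℕ) {s : ℝ} (hs : s ∈ Ioo 0 g) :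
    testFun g ζ φ (s + n * g) = ζ ^ n * φ s := by
  have h : ⌊(s + n * g) / g⌋ = (n : ℤ) := by
    rw [← Int.natCast_floor_eq_floor (div_nonneg (by have := hs.1; positivity) hg.le),
      floor_add_mul_div hg n hs]
  rw [testFun, h]
  simp

lemma measurable_testFun (ζ : ℂ) {φ : ℝ → ℝ} (hφ : Measurable φ) :
    Measurable (testFun g ζ φ) := by
  have h1 : Measurable fun t : ℝ => ⌊t / g⌋ := Int.measurable_floor.comp (measurable_id.div_const g)
  have h2 : Measurable fun t : ℝ => ζ ^ ⌊t / g⌋ :=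
    (measurable_from_top (f := fun k : ℤ => ζ ^ k)).comp h1
  have h3 : Measurable fun t : ℝ => ((⌊t / g⌋ : ℤ) : ℝ) :=
    (measurable_from_top (f := fun k : ℤ => (k : ℝ))).comp h1
  exact h2.mul (Complex.measurable_ofReal.comp (hφ.comp (measurable_id.sub (h3.mul_const g))))

lemma norm_testFun_le {ζ : ℂ} (hζ : ‖ζ‖ = 1) {φ : ℝ → ℝ} {B : ℝ} (hB : ∀ s, |φ s| ≤ B) (t : ℝ) :
    ‖testFun g ζ φ t‖ ≤ B := by
  rw [testFun, norm_mul, norm_zpow, hζ, one_zpow, one_mul, Complex.norm_real]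
  exact hB _

/-- The mean value of the test function is zero because `∑ ζ ^ n = 0` if `ζ ≠ 1`, and because of the
hypothesis on `φ` if `ζ = 1`. -/
lemma testFun_mem (hg : 0 < g) {m : ℕ} (hm : 0 < m) {ζ : ℂ} (hζ : ζ ^ m = 1) {φ : ℝ → ℝ}
    (hφ : Measurable φ) {B : ℝ} (hB : ∀ s, |φ s| ≤ B)
    (h0 : ζ = 1 → ∫ s in Ioo 0 g, φ s = 0) :
    testFun g ζ φ ∈ periodicZeroMean (m * g) := by
  have hn : ‖ζ‖ = 1 := Complex.norm_eq_one_of_pow_eq_one hζ hm.ne'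
  have hmeas := measurable_testFun (g := g) ζ hφ
  have hloc : ∀ K : Set ℝ, IsCompact K → MemLp (testFun g ζ φ) ⊤ (volume.restrict K) :=
    fun K _ => memLp_top_of_bound hmeas.aestronglyMeasurable B
      (Filter.Eventually.of_forall fun t => norm_testFun_le hn hB t)
  have hfin : ∀ K : Set ℝ, IsCompact K → IsFiniteMeasure (volume.restrict K) := fun K hK =>
    ⟨by simpa using hK.measure_lt_top⟩
  refine ⟨fun K hK => ?_, fun t => ?_, ?_⟩
  · have := hfin K hK
    exact (hloc K hK).mono_exponent le_top
  · have h1 : (t + m * g) / g = t / g + m := by field_simp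
    have hζ0 : ζ ≠ 0 := fun h => by simp [h] at hn
    rw [testFun, testFun, h1, Int.floor_add_natCast, zpow_add₀ hζ0, zpow_natCast, hζ, mul_one]
    congr 3
    push_cast; ring
  · have hI : IntegrableOn (testFun g ζ φ) (Ioo 0 (m * g)) := by
      have := hfin (Icc 0 (m * g)) isCompact_Icc
      exact IntegrableOn.mono_set ((hloc (Icc 0 (m * g)) isCompact_Icc).integrable le_top)
        Ioo_subset_Icc_self
    rw [intervalIntegral.integral_of_le (by positivity), integral_Ioc_eq_integral_Ioo,
      setIntegral_Ioo_eq_sum hg hI]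
    have h2 : ∀ n ∈ Finset.range m, ∫ s in Ioo 0 g, testFun g ζ φ (s + n * g) =
        ζ ^ n * ((∫ s in Ioo 0 g, φ s : ℝ) : ℂ) := by
      intro n _
      rw [← integral_complex_ofReal, ← integral_const_mul]
      exact setIntegral_congr_fun measurableSet_Ioo fun s hs => testFun_add_mul hg ζ φ n hs
    rw [Finset.sum_congr rfl h2, ← Finset.sum_mul]
    by_cases h1 : ζ = 1
    · rw [h0 h1]; simp
    · have h3 := geom_sum_mul ζ m
      rw [hζ, sub_self] at h3
      rw [(mul_eq_zero.1 h3).resolve_right (sub_ne_zero.2 h1), zero_mul]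

/-- Pairing `U` with a test function gives `∫ φ s * A_s(w)`, where `A_s` is the polynomial with the
coefficients `U (s + n g)`. -/
lemma integral_conj_testFun_mul (hg : 0 < g) {N : ℕ} {U : ℝ → ℂ}
    (hU : IntegrableOn U (Ioo 0 (N * g))) {w : ℂ} (hw : ‖w‖ = 1) {φ : ℝ → ℝ} (hφ : Measurable φ)
    {B : ℝ} (hB : ∀ s, |φ s| ≤ B) :
    ∫ t in Ioo 0 (N * g), conj (testFun g (conj w) φ t) * U t =
      ∫ s in Ioo 0 g, φ s * ∑ n ∈ Finset.range N, w ^ n * U (s + n * g) := by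
  have hw' : ‖conj w‖ = 1 := by rwa [RCLike.norm_conj]
  have hI : IntegrableOn (fun t => conj (testFun g (conj w) φ t) * U t) (Ioo 0 (N * g)) := by
    refine Integrable.bdd_mul (c := B) hU
      (Complex.continuous_conj.measurable.comp (measurable_testFun _ hφ)).aestronglyMeasurable ?_
    exact Filter.Eventually.of_forall fun t => by
      rw [RCLike.norm_conj]; exact norm_testFun_le hw' hB t
  rw [setIntegral_Ioo_eq_sum hg hI, ← integral_finsetSum]
  · refine setIntegral_congr_fun measurableSet_Ioo fun s hs => ?_
    simp only [Finset.mul_sum]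
    refine Finset.sum_congr rfl fun n _ => ?_
    rw [testFun_add_mul hg _ φ n hs]
    simp only [map_mul, map_pow, Complex.conj_conj, Complex.conj_ofReal]
    ring
  · intro n hn
    exact integrableOn_comp_add_mul hg hI (Finset.mem_range.1 hn)

lemma integrableOn_sum_pow_mul {N : ℕ} {U : ℝ → ℂ} (hg : 0 < g)
    (hU : IntegrableOn U (Ioo 0 (N * g))) (w : ℂ) :
    IntegrableOn (fun s => ∑ n ∈ Finset.range N, w ^ n * U (s + n * g)) (Ioo 0 g) :=
  integrable_finsetSum _ fun _ hn =>
    (integrableOn_comp_add_mul hg hU (Finset.mem_range.1 hn)).const_mul _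

/-- `A_s(w) = 0` for almost all `s` if `w ≠ 1` is an `m`-th root of unity. -/
lemma ae_sum_eq_zero (hg : 0 < g) {N m : ℕ} (hm : 0 < m) {U : ℝ → ℂ}
    (hU : IntegrableOn U (Ioo 0 (N * g)))
    (horth : ∀ f ∈ periodicZeroMean (m * g), ∫ t in Ioo 0 (N * g), conj (f t) * U t = 0)
    {w : ℂ} (hw : w ^ m = 1) (hw1 : w ≠ 1) :
    ∀ᵐ s ∂volume.restrict (Ioo 0 g), ∑ n ∈ Finset.range N, w ^ n * U (s + n * g) = 0 := by
  refine (integrableOn_sum_pow_mul hg hU w).ae_eq_zero_of_forall_setIntegral_eq_zero fun E hE _ => ?_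
  have hB : ∀ s, |E.indicator (fun _ => (1 : ℝ)) s| ≤ 1 := by
    intro s
    by_cases h : s ∈ E <;> simp [h]
  have hmeas : Measurable (E.indicator fun _ => (1 : ℝ)) := measurable_const.indicator hE
  have h := horth _ (testFun_mem hg hm (ζ := conj w) (by rw [← map_pow, hw, map_one]) hmeas hB
    fun h => absurd (by simpa using congrArg conj h) hw1)
  rw [integral_conj_testFun_mul hg hU (Complex.norm_eq_one_of_pow_eq_one hw hm.ne') hmeas hB] at h
  rw [← integral_indicator hE, ← h]
  refine integral_congr_ae (Filter.Eventually.of_forall fun s => ?_)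
  by_cases hs : s ∈ E <;> simp [hs]

/-- `A_s(1)` does not depend on `s`, up to a null set. -/
lemma exists_ae_sum_eq_const (hg : 0 < g) {N m : ℕ} (hm : 0 < m) {U : ℝ → ℂ}
    (hU : IntegrableOn U (Ioo 0 (N * g)))
    (horth : ∀ f ∈ periodicZeroMean (m * g), ∫ t in Ioo 0 (N * g), conj (f t) * U t = 0) :
    ∃ M : ℂ, ∀ᵐ s ∂volume.restrict (Ioo 0 g), ∑ n ∈ Finset.range N, U (s + n * g) = M := by
  set G : ℝ → ℂ := fun s => ∑ n ∈ Finset.range N, U (s + n * g) with hG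
  have hGint : IntegrableOn G (Ioo 0 g) := by simpa using integrableOn_sum_pow_mul hg hU 1
  have hconst : ∀ z : ℂ, Integrable (fun _ : ℝ => z) (volume.restrict (Ioo 0 g)) := fun z =>
    integrable_const z
  refine ⟨(∫ s in Ioo 0 g, G s) / g, ?_⟩
  have key : (fun s => G s - (∫ s in Ioo 0 g, G s) / g) =ᵐ[volume.restrict (Ioo 0 g)] 0 := by
    refine (hGint.sub (hconst _)).ae_eq_zero_of_forall_setIntegral_eq_zero fun E hE _ => ?_
    set v : ℝ := (volume.restrict (Ioo 0 g)).real E with hv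
    -- the indicator of `E` minus its mean value
    set φ : ℝ → ℝ := fun s => E.indicator (fun _ => (1 : ℝ)) s - v / g with hφ
    have hB : ∀ s, |φ s| ≤ 1 + |v / g| := by
      intro s
      refine (abs_sub _ _).trans (add_le_add ?_ le_rfl)
      by_cases h : s ∈ E <;> simp [h]
    have hind : Measurable (E.indicator fun _ => (1 : ℝ)) := measurable_const.indicator hE
    have hmeas : Measurable φ := hind.sub_const _
    have hmean : ∫ s in Ioo 0 g, φ s = 0 := by
      rw [hφ, integral_sub ((integrable_const (1 : ℝ)).indicator hE) (integrable_const _),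
        integral_indicator_const _ hE]
      simp [hg.le, ← hv]
      field_simp
      ring
    have h := horth _ (testFun_mem hg hm (ζ := conj 1) (by simp) hmeas hB fun _ => hmean)
    rw [integral_conj_testFun_mul hg hU (by simp) hmeas hB] at h
    simp only [one_pow, one_mul] at h
    have h2 : ∀ s, (φ s : ℂ) * ∑ n ∈ Finset.range N, U (s + n * g) =
        E.indicator G s - (v / g : ℝ) * G s := by
      intro s
      by_cases hs : s ∈ E <;> simp [hφ, hs, hG, sub_mul]
    simp only [h2] at h
    rw [integral_sub (hGint.integrable.indicator hE) (hGint.integrable.const_mul _),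
      integral_indicator hE, integral_const_mul] at h
    simp only [Pi.sub_apply]
    rw [integral_sub hGint.integrable.integrableOn (hconst _).integrableOn, setIntegral_const,
      ← hv, ← h]
    simp only [Complex.real_smul]
    push_cast
    ring
  filter_upwards [key] with s hs
  exact sub_eq_zero.1 hs

open Polynomial in
/-- A function on `(0, N g)`, `N = deg Q + 1`, that is orthogonal to the three spaces is a multiple of
the step function with the coefficients of `Q`. -/
lemma exists_ae_eq_const_mul_coeff (hg : 0 < g) {a b c : ℕ} (hgcd : (a.gcd b).gcd c = 1)
    (ha : 0 < a) (hb : 0 < b) (hc : 0 < c) {N : ℕ} (hN : N = (gapPoly a b c).natDegree + 1)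
    {U : ℝ → ℂ} (hU : IntegrableOn U (Ioo 0 (N * g)))
    (horth : ∀ m, m = a ∨ m = b ∨ m = c → ∀ f ∈ periodicZeroMean (m * g),
      ∫ t in Ioo 0 (N * g), conj (f t) * U t = 0) :
    ∃ κ : ℂ, ∀ᵐ t ∂volume.restrict (Ioo 0 (N * g)),
      U t = κ * (gapPoly a b c).coeff ⌊t / g⌋₊ := by
  obtain ⟨M, hM⟩ := exists_ae_sum_eq_const hg ha hU (horth a (Or.inl rfl))
  have hroots : ∀ᵐ s ∂volume.restrict (Ioo 0 g), ∀ w ∈ nontrivialRoots a b c,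
      ∑ n ∈ Finset.range N, w ^ n * U (s + n * g) = 0 := by
    refine (ae_ball_iff (S := (nontrivialRoots a b c : Set ℂ)) (Finset.countable_toSet _)).2 ?_
    intro w hw
    obtain ⟨hw1, hw⟩ := (mem_nontrivialRoots ha hb hc).1 hw
    rcases hw with hw | hw | hw
    · exact ae_sum_eq_zero hg ha hU (horth a (by simp)) hw hw1
    · exact ae_sum_eq_zero hg hb hU (horth b (by simp)) hw hw1
    · exact ae_sum_eq_zero hg hc hU (horth c (by simp)) hw hw1
  set Q := (gapPoly a b c).map (Nat.castRingHom ℂ) with hQ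
  have hQ1 : Q.eval 1 ≠ 0 := by
    have h1 : Q.eval 1 = (((gapPoly a b c).eval 1 : ℕ) : ℂ) := by
      rw [hQ, eval_map, ← Nat.cast_one, eval₂_at_natCast]; simp
    rw [h1, Nat.cast_ne_zero, eval_eq_sum_range]
    refine fun h => one_ne_zero (α := ℕ) ?_
    have := Finset.sum_eq_zero_iff.1 h 0 (by simp)
    simp [gapPoly_coeff_zero ha hb hc] at this
  -- the factor `κ` in `A_s = κ Q` is found by evaluating at `1`
  refine ⟨M / Q.eval 1, ?_⟩
  have hshift : ∀ᵐ s ∂volume.restrict (Ioo 0 g), ∀ n < N,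
      U (s + n * g) = M / Q.eval 1 * (gapPoly a b c).coeff n := by
    filter_upwards [hM, hroots] with s h1 h2 n hn
    set A : ℂ[X] := ∑ n ∈ Finset.range N, monomial n (U (s + n * g)) with hA
    have heval : ∀ w, A.eval w = ∑ n ∈ Finset.range N, w ^ n * U (s + n * g) := by
      intro w
      simp [hA, eval_finsetSum, mul_comm]
    have hdeg : A.natDegree ≤ (gapPoly a b c).natDegree := by
      refine natDegree_sum_le_of_forall_le _ _ fun i hi => (natDegree_monomial_le _).trans ?_
      have := Finset.mem_range.1 hi
      omega
    have hAQ := eq_C_mul_gapPoly hgcd ha hb hc hdeg fun w hw => (heval w).trans (h2 w hw)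
    rw [← hQ] at hAQ
    set κ := A.coeff (gapPoly a b c).natDegree
    have hκ : κ = M / Q.eval 1 := by
      rw [eq_div_iff hQ1, ← h1]
      have h3 := heval 1
      rw [hAQ, eval_mul, eval_C] at h3
      simpa using h3
    have hcoeff : A.coeff n = U (s + n * g) := by
      simp [hA, finsetSum_coeff, coeff_monomial, hn]
    rw [← hcoeff, hAQ, coeff_C_mul, hκ, hQ, coeff_map]
    simp
  rw [ae_restrict_iff' measurableSet_Ioo] at hshift ⊢
  -- transport the statement from `s ∈ (0, g)` to `t = s + n g`, off the null set of multiples of `g`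
  have hmove : ∀ᵐ t : ℝ, ∀ n : ℕ, t - n * g ∈ Ioo 0 g → ∀ k < N,
      U (t - n * g + k * g) = M / Q.eval 1 * (gapPoly a b c).coeff k :=
    ae_all_iff.2 fun n =>
      (measurePreserving_sub_right volume ((n : ℝ) * g)).quasiMeasurePreserving.ae hshift
  have hne : ∀ᵐ t : ℝ, ∀ n : ℕ, t ≠ n * g := ae_all_iff.2 fun n => Measure.ae_ne volume _
  filter_upwards [hmove, hne] with t h1 h2 ht
  have h3 := Nat.floor_le (div_nonneg ht.1.le hg.le)
  have h4 := Nat.lt_floor_add_one (t / g)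
  rw [le_div_iff₀ hg] at h3
  rw [div_lt_iff₀ hg] at h4
  have h5 : ⌊t / g⌋₊ < N := by
    rw [Nat.floor_lt (div_nonneg ht.1.le hg.le), div_lt_iff₀ hg]
    exact ht.2
  have h6 := h1 ⌊t / g⌋₊ ⟨sub_pos.2 (lt_of_le_of_ne h3 (h2 _).symm), by linarith⟩ _ h5
  rwa [sub_add_cancel] at h6

/-- The step function with the coefficients of `Q` is orthogonal to the three spaces. The length `L`
may exceed `(deg Q + 1) g`, where the step function vanishes. -/
lemma integral_conj_mul_coeff_eq_zero (hg : 0 < g) {a b c m : ℕ} (hgcd : (a.gcd b).gcd c = 1)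
    (hm : 0 < m) (hmabc : m = a ∨ m = b ∨ m = c) {L : ℝ}
    (hL : ((gapPoly a b c).natDegree + 1) * g ≤ L) {f : ℝ → ℂ}
    (hf : f ∈ periodicZeroMean (m * g)) :
    ∫ t in Ioo 0 L, conj (f t) * (((gapPoly a b c).coeff ⌊t / g⌋₊ : ℝ) : ℂ) = 0 := by
  obtain ⟨hloc, hper, hmean⟩ := hf
  set N := (gapPoly a b c).natDegree + 1 with hN
  have hfI : ∀ R : ℝ, IntegrableOn (fun t => conj (f t)) (Ioo 0 R) := by
    intro R
    have : IsFiniteMeasure (volume.restrict (Icc 0 R)) :=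
      ⟨by simp⟩
    have h := (hloc (Icc 0 R) isCompact_Icc).integrable (by norm_num)
    exact IntegrableOn.mono_set (Complex.conjCLE.toContinuousLinearMap.integrable_comp h)
      Ioo_subset_Icc_self
  have hN' : (N : ℝ) * g ≤ L := by rw [hN]; push_cast; exact hL
  have hvan : ∫ t in Ioo 0 L, conj (f t) * (((gapPoly a b c).coeff ⌊t / g⌋₊ : ℝ) : ℂ) =
      ∫ t in Ioo 0 (N * g), conj (f t) * (((gapPoly a b c).coeff ⌊t / g⌋₊ : ℝ) : ℂ) := by
    refine setIntegral_eq_of_subset_of_forall_sdiff_eq_zero measurableSet_Ioo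
      (Ioo_subset_Ioo_right hN') fun t ht => ?_
    have h1 : N * g ≤ t := by
      by_contra h
      exact ht.2 ⟨ht.1.1, not_le.1 h⟩
    have h2 : N ≤ ⌊t / g⌋₊ := Nat.le_floor ((le_div_iff₀ hg).2 h1)
    rw [Polynomial.coeff_eq_zero_of_natDegree_lt (by omega)]
    simp
  have hmeas : Measurable fun t : ℝ => (((gapPoly a b c).coeff ⌊t / g⌋₊ : ℝ) : ℂ) :=
    (measurable_from_top (f := fun k : ℕ => (((gapPoly a b c).coeff k : ℝ) : ℂ))).comp
      (Nat.measurable_floor.comp (measurable_id.div_const g))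
  have hI : IntegrableOn (fun t => conj (f t) * (((gapPoly a b c).coeff ⌊t / g⌋₊ : ℝ) : ℂ))
      (Ioo 0 (N * g)) := by
    refine Integrable.mul_bdd (c := ((∑ k ∈ Finset.range N, (gapPoly a b c).coeff k : ℕ) : ℝ))
      (hfI _) hmeas.aestronglyMeasurable (Filter.Eventually.of_forall fun t => ?_)
    rw [Complex.norm_real, Real.norm_natCast]
    norm_cast
    by_cases h : ⌊t / g⌋₊ < N
    · exact Finset.single_le_sum (f := fun k => (gapPoly a b c).coeff k)
        (fun _ _ => Nat.zero_le _) (Finset.mem_range.2 h)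
    · rw [Polynomial.coeff_eq_zero_of_natDegree_lt (by omega)]
      exact Nat.zero_le _
  rw [hvan, setIntegral_Ioo_eq_sum hg hI]
  -- the integrals of `conj f` over the unit intervals form an `m`-periodic sequence of mean zero
  set F : ℕ → ℂ := fun n => ∫ s in Ioo 0 g, conj (f (s + n * g)) with hF
  have hterm : ∀ n ∈ Finset.range N, ∫ s in Ioo 0 g, conj (f (s + n * g)) *
      (((gapPoly a b c).coeff ⌊(s + n * g) / g⌋₊ : ℝ) : ℂ) = (gapPoly a b c).coeff n * F n := by
    intro n _
    simp only [hF]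
    rw [mul_comm ((gapPoly a b c).coeff n : ℂ), ← integral_mul_const]
    refine setIntegral_congr_fun measurableSet_Ioo fun s hs => ?_
    simp only [floor_add_mul_div hg n hs, Complex.ofReal_natCast]
  rw [Finset.sum_congr rfl hterm]
  refine sum_coeff_mul_periodic hgcd hm hmabc (fun n => ?_) ?_ N (by omega)
  · simp only [hF]
    congr 1
    funext s
    have : s + ((n + m : ℕ) : ℝ) * g = s + n * g + m * g := by push_cast; ring
    rw [this, hper]
  · have h := setIntegral_Ioo_eq_sum (N := m) hg (hfI (m * g))
    rw [← hF] at *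
    rw [← h, integral_conj, ← integral_Ioc_eq_integral_Ioo,
      ← intervalIntegral.integral_of_le (by positivity), hmean, map_zero]

/-! ### Orthogonality to the sum of the three spaces -/

/-- Orthogonality to the three summands implies orthogonality to the sum. Square integrability is
proved along with it, because it is needed to split the integrals. -/
lemma memLp_and_integral_eq_zero {T : Fin 3 → ℕ} {L : ℝ} (u : L2Interval L)
    (h : ∀ i, ∀ f ∈ periodicZeroMean (T i), ∫ t in Ioo 0 L, conj (f t) * u t = 0)
    {f : ℝ → ℂ} (hf : f ∈ periodSum T) :
    MemLp f 2 (volume.restrict (Ioo 0 L)) ∧ ∫ t in Ioo 0 L, conj (f t) * u t = 0 := by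
  induction hf using Submodule.iSup_induction' with
  | mem i f hf =>
    exact ⟨(hf.1 (Icc 0 L) isCompact_Icc).mono_measure
      (Measure.restrict_mono_set _ Ioo_subset_Icc_self), h i f hf⟩
  | zero => exact ⟨MemLp.zero, by simp⟩
  | add f₁ f₂ _ _ h₁ h₂ =>
    refine ⟨h₁.1.add h₂.1, ?_⟩
    have hI : ∀ f : ℝ → ℂ, MemLp f 2 (volume.restrict (Ioo 0 L)) →
        Integrable (fun t => conj (f t) * u t) (volume.restrict (Ioo 0 L)) := fun f hf =>
      MemLp.integrable_mul (p := 2) (q := 2) hf.star (Lp.memLp u)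
    simp only [Pi.add_apply, map_add, add_mul]
    rw [integral_add (hI _ h₁.1) (hI _ h₂.1), h₁.2, h₂.2, add_zero]

/-- An element of `L²(0, L)` is orthogonal to `X` iff it is orthogonal to each summand, where
orthogonality is expressed by integrals of functions. -/
lemma mem_orthogonal_iff {T : Fin 3 → ℕ} {L : ℝ} (u : L2Interval L) :
    u ∈ (restrictL2 (periodSum T) L)ᗮ ↔
      ∀ i, ∀ f ∈ periodicZeroMean (T i), ∫ t in Ioo 0 L, conj (f t) * u t = 0 := by
  rw [Submodule.mem_orthogonal]
  have hinner : ∀ (v : L2Interval L) (f : ℝ → ℂ), v =ᵐ[volume.restrict (Ioo 0 L)] f →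
      inner ℂ v u = ∫ t in Ioo 0 L, conj (f t) * u t := by
    intro v f hvf
    rw [L2.inner_def]
    refine integral_congr_ae ?_
    filter_upwards [hvf] with t ht
    rw [ht, RCLike.inner_apply, mul_comm]
  constructor
  · intro h i f hf
    have hL : MemLp f 2 (volume.restrict (Ioo 0 L)) :=
      (hf.1 (Icc 0 L) isCompact_Icc).mono_measure
        (Measure.restrict_mono_set _ Ioo_subset_Icc_self)
    rw [← hinner (hL.toLp f) f hL.coeFn_toLp]
    exact h _ ⟨f, Submodule.mem_iSup_of_mem i hf, hL.coeFn_toLp⟩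
  · rintro h v ⟨f, hf, hvf⟩
    rw [hinner v f hvf]
    exact (memLp_and_integral_eq_zero u h hf).2

end

/-! ### The step function of three integer periods -/

section

open scoped ComplexConjugate

/-- The polynomial `Q` of the periods divided by their greatest common divisor. -/
def periodPoly (T : Fin 3 → ℕ) : Polynomial ℕ :=
  gapPoly (T 0 / gcdThree T) (T 1 / gcdThree T) (T 2 / gcdThree T)

/-- The step function whose values on the intervals `[n g, (n + 1) g)`, `n ≥ 0`, are the coefficients
of `Q`. It vanishes beyond the critical length; its values at negative numbers, where the natural
floor is zero, play no role. -/
def gapStep (T : Fin 3 → ℕ) (t : ℝ) : ℝ := (periodPoly T).coeff ⌊t / gcdThree T⌋₊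

section

variable {T : Fin 3 → ℕ}

lemma gcdThree_dvd (T : Fin 3 → ℕ) (i : Fin 3) : gcdThree T ∣ T i := by
  have h := Nat.gcd_dvd_left ((T 0).gcd (T 1)) (T 2)
  fin_cases i
  · exact h.trans (Nat.gcd_dvd_left _ _)
  · exact h.trans (Nat.gcd_dvd_right _ _)
  · exact Nat.gcd_dvd_right _ _

lemma gcdThree_pos (hT : ∀ i, 0 < T i) : 0 < gcdThree T :=
  Nat.pos_of_dvd_of_pos (gcdThree_dvd T 0) (hT 0)

lemma div_gcdThree_pos (hT : ∀ i, 0 < T i) (i : Fin 3) : 0 < T i / gcdThree T :=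
  Nat.div_pos (Nat.le_of_dvd (hT i) (gcdThree_dvd T i)) (gcdThree_pos hT)

lemma gcd_div_mul (T : Fin 3 → ℕ) (i j : Fin 3) :
    (T i / gcdThree T).gcd (T j / gcdThree T) * gcdThree T = (T i).gcd (T j) := by
  rw [← Nat.gcd_mul_right, Nat.div_mul_cancel (gcdThree_dvd T i),
    Nat.div_mul_cancel (gcdThree_dvd T j)]

lemma gcd_div_gcdThree (hT : ∀ i, 0 < T i) :
    ((T 0 / gcdThree T).gcd (T 1 / gcdThree T)).gcd (T 2 / gcdThree T) = 1 := by
  apply Nat.eq_of_mul_eq_mul_right (gcdThree_pos hT)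
  rw [← Nat.gcd_mul_right, gcd_div_mul, Nat.div_mul_cancel (gcdThree_dvd T 2), one_mul]
  rfl

lemma natCast_period_eq (T : Fin 3 → ℕ) (i : Fin 3) :
    (T i : ℝ) = ((T i / gcdThree T : ℕ) : ℝ) * gcdThree T := by
  rw [← Nat.cast_mul, Nat.div_mul_cancel (gcdThree_dvd T i)]

/-- The critical length is `(deg Q + 1) g`. -/
lemma criticalLength_eq (hT : ∀ i, 0 < T i) :
    criticalLength T = (((periodPoly T).natDegree + 1 : ℕ) : ℝ) * gcdThree T := by
  have h0 := div_gcdThree_pos hT 0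
  have h1 := div_gcdThree_pos hT 1
  have h2 := div_gcdThree_pos hT 2
  rw [periodPoly, natDegree_gapPoly h0 h1 h2]
  push_cast [Nat.cast_sub (Nat.le_of_dvd h0 (Nat.gcd_dvd_left _ (T 1 / gcdThree T))),
    Nat.cast_sub (Nat.le_of_dvd h1 (Nat.gcd_dvd_left _ (T 2 / gcdThree T))),
    Nat.cast_sub (Nat.le_of_dvd h2 (Nat.gcd_dvd_left _ (T 0 / gcdThree T)))]
  rw [criticalLength, ← gcd_div_mul T 0 1, ← gcd_div_mul T 1 2, ← gcd_div_mul T 2 0]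
  push_cast
  linear_combination natCast_period_eq T 0 + natCast_period_eq T 1 + natCast_period_eq T 2

lemma criticalLength_pos (hT : ∀ i, 0 < T i) : 0 < criticalLength T := by
  have := gcdThree_pos hT
  rw [criticalLength_eq hT]
  positivity

lemma measurable_gapStep (T : Fin 3 → ℕ) : Measurable (gapStep T) :=
  (measurable_from_top (f := fun k : ℕ => ((periodPoly T).coeff k : ℝ))).comp
    (Nat.measurable_floor.comp (measurable_id.div_const _))

lemma gapStep_nonneg (T : Fin 3 → ℕ) (t : ℝ) : 0 ≤ gapStep T t := Nat.cast_nonneg _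

lemma memLp_gapStep (T : Fin 3 → ℕ) (L : ℝ) :
    MemLp (fun t => (gapStep T t : ℂ)) 2 (volume.restrict (Ioo 0 L)) := by
  refine MemLp.of_bound (Complex.measurable_ofReal.comp
    (measurable_gapStep T)).aestronglyMeasurable
    (((periodPoly T).eval 1 : ℕ) : ℝ) (Filter.Eventually.of_forall fun t => ?_)
  rw [Complex.norm_real, gapStep, Real.norm_natCast, Nat.cast_le,
    Polynomial.eval_eq_sum_range]
  simp only [one_pow, mul_one]
  by_cases h : ⌊t / gcdThree T⌋₊ ≤ (periodPoly T).natDegree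
  · exact Finset.single_le_sum (f := fun k => (periodPoly T).coeff k)
      (fun _ _ => Nat.zero_le _) (Finset.mem_range.2 (Nat.lt_succ_of_le h))
  · rw [Polynomial.coeff_eq_zero_of_natDegree_lt (not_le.1 h)]
    exact Nat.zero_le _

lemma gapStep_mem_orthogonal (hT : ∀ i, 0 < T i) {L : ℝ} (hL : criticalLength T ≤ L) :
    (memLp_gapStep T L).toLp _ ∈ (restrictL2 (periodSum T) L)ᗮ := by
  rw [mem_orthogonal_iff]
  intro i f hf
  have h1 : ∫ t in Ioo 0 L, conj (f t) * (memLp_gapStep T L).toLp _ t =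
      ∫ t in Ioo 0 L, conj (f t) * (gapStep T t : ℂ) := by
    refine integral_congr_ae ?_
    filter_upwards [(memLp_gapStep T L).coeFn_toLp] with t ht
    rw [ht]
  rw [h1]
  rw [natCast_period_eq T i] at hf
  rw [criticalLength_eq hT] at hL
  push_cast at hL
  refine integral_conj_mul_coeff_eq_zero (Nat.cast_pos.2 (gcdThree_pos hT)) (gcd_div_gcdThree hT)
    (div_gcdThree_pos hT i) ?_ hL hf
  fin_cases i <;> simp

/-- On an interval of at most critical length the functions orthogonal to `X`, extended by zero,
are the multiples of `gapStep`. -/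
lemma exists_ae_eq_mul_gapStep (hT : ∀ i, 0 < T i) {L : ℝ} (hL : L ≤ criticalLength T)
    {u : L2Interval L} (hu : u ∈ (restrictL2 (periodSum T) L)ᗮ) :
    ∃ κ : ℂ, ∀ᵐ t ∂volume.restrict (Ioo 0 (criticalLength T)),
      (Ioo 0 L).indicator u t = κ * gapStep T t := by
  rw [mem_orthogonal_iff] at hu
  have hU : IntegrableOn ((Ioo 0 L).indicator u) (Ioo 0 (criticalLength T)) :=
    (IntegrableOn.integrable_indicator ((Lp.memLp u).integrable (by norm_num))
      measurableSet_Ioo).integrableOn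
  have hg : (0 : ℝ) < gcdThree T := Nat.cast_pos.2 (gcdThree_pos hT)
  have horth : ∀ i, ∀ f ∈ periodicZeroMean (T i),
      ∫ t in Ioo 0 (criticalLength T), conj (f t) * (Ioo 0 L).indicator u t = 0 := by
    intro i f hf
    rw [← hu i f hf, setIntegral_eq_of_subset_of_forall_sdiff_eq_zero measurableSet_Ioo
      (Ioo_subset_Ioo_right hL) fun t ht => by rw [indicator_of_notMem ht.2, mul_zero]]
    refine setIntegral_congr_fun measurableSet_Ioo fun t ht => ?_
    simp only [indicator_of_mem ht]
  rw [criticalLength_eq hT] at *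
  obtain ⟨κ, hκ⟩ := exists_ae_eq_const_mul_coeff hg (gcd_div_gcdThree hT) (div_gcdThree_pos hT 0)
    (div_gcdThree_pos hT 1) (div_gcdThree_pos hT 2) rfl hU (by
      rintro m (rfl | rfl | rfl) f hf
      · exact horth 0 f (by rwa [natCast_period_eq T 0])
      · exact horth 1 f (by rwa [natCast_period_eq T 1])
      · exact horth 2 f (by rwa [natCast_period_eq T 2]))
  refine ⟨κ, ?_⟩
  filter_upwards [hκ] with t ht
  rw [ht, gapStep, periodPoly, Complex.ofReal_natCast]

lemma exists_mem_of_ae_restrict {s : Set ℝ} (hs : MeasurableSet s) (h0 : volume s ≠ 0)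
    {p : ℝ → Prop} (h : ∀ᵐ t ∂volume.restrict s, p t) : ∃ t ∈ s, p t := by
  have : Filter.NeBot (ae (volume.restrict s)) := ae_restrict_neBot.2 h0
  obtain ⟨t, h1, h2⟩ := ((ae_restrict_mem hs).and h).exists
  exact ⟨t, h1, h2⟩

lemma gapStep_of_mem (hT : ∀ i, 0 < T i) {n : ℕ} {t : ℝ}
    (ht : t ∈ Ico ((n : ℝ) * gcdThree T) ((n + 1) * gcdThree T)) :
    gapStep T t = (periodPoly T).coeff n := by
  have hg : (0 : ℝ) < gcdThree T := Nat.cast_pos.2 (gcdThree_pos hT)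
  rw [gapStep, (Nat.floor_eq_iff (div_nonneg (le_trans (by positivity) ht.1) hg.le)).2
    ⟨(le_div_iff₀ hg).2 ht.1, (div_lt_iff₀ hg).2 ht.2⟩]

lemma gapStep_first (hT : ∀ i, 0 < T i) {t : ℝ} (ht : t ∈ Ioo (0 : ℝ) (gcdThree T)) :
    gapStep T t = 1 := by
  rw [gapStep_of_mem hT (n := 0) ⟨by simpa using ht.1.le, by simpa using ht.2⟩, periodPoly,
    gapPoly_coeff_zero (div_gcdThree_pos hT 0) (div_gcdThree_pos hT 1) (div_gcdThree_pos hT 2)]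
  simp

/-- `gapStep = 1` on the last unit interval, because `Q` is monic. -/
lemma gapStep_last (hT : ∀ i, 0 < T i) {t : ℝ} (h1 : criticalLength T - gcdThree T ≤ t)
    (h2 : t < criticalLength T) : gapStep T t = 1 := by
  rw [criticalLength_eq hT] at h1 h2
  push_cast at h1 h2
  have hmonic : (periodPoly T).Monic := monic_gapPoly (div_gcdThree_pos hT 0)
    (div_gcdThree_pos hT 1) (div_gcdThree_pos hT 2)
  rw [gapStep_of_mem hT (n := (periodPoly T).natDegree) ⟨by linarith, h2⟩,
    hmonic.coeff_natDegree, Nat.cast_one]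

lemma gcdThree_le_criticalLength (hT : ∀ i, 0 < T i) : (gcdThree T : ℝ) ≤ criticalLength T := by
  rw [criticalLength_eq hT]
  push_cast
  have : (0 : ℝ) ≤ (periodPoly T).natDegree * gcdThree T := by positivity
  linarith

/-! ### Critical length and normalized generators -/

lemma dense_iff {L : ℝ} : Dense (restrictL2 (periodSum T) L : Set (L2Interval L)) ↔
    (restrictL2 (periodSum T) L)ᗮ = ⊥ := by
  rw [Submodule.dense_iff_topologicalClosure_eq_top, Submodule.topologicalClosure_eq_top_iff]

lemma isCriticalLength_periodSum (hT : ∀ i, 0 < T i) :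
    IsCriticalLength (periodSum T) (criticalLength T) := by
  have hg : (0 : ℝ) < gcdThree T := Nat.cast_pos.2 (gcdThree_pos hT)
  have hgT := gcdThree_le_criticalLength hT
  refine ⟨criticalLength_pos hT, fun L hL0 hL => ?_, fun L hL => ?_⟩
  · rw [dense_iff, Submodule.eq_bot_iff]
    intro u hu
    obtain ⟨κ, hκ⟩ := exists_ae_eq_mul_gapStep hT hL.le hu
    -- compare both sides where `u` is extended by zero and `gapStep = 1`
    have hκ0 : κ = 0 := by
      obtain ⟨t, ht, h⟩ := exists_mem_of_ae_restrict
        (s := Ioo (max L (criticalLength T - gcdThree T)) (criticalLength T)) measurableSet_Ioo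
        (by
          rw [Real.volume_Ioo, Ne, ENNReal.ofReal_eq_zero, not_le, sub_pos]
          exact max_lt hL (by linarith))
        (ae_restrict_of_ae_restrict_of_subset
          (Ioo_subset_Ioo_left (hL0.le.trans (le_max_left _ _))) hκ)
      rw [indicator_of_notMem fun h => (h.2.trans_le (le_max_left _ _)).not_gt ht.1,
        gapStep_last hT ((le_max_right _ _).trans ht.1.le) ht.2] at h
      simpa using h.symm
    rw [Lp.eq_zero_iff_ae_eq_zero]
    filter_upwards [ae_restrict_of_ae_restrict_of_subset (Ioo_subset_Ioo_right hL.le) hκ,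
      ae_restrict_mem measurableSet_Ioo] with t h1 h2
    rw [indicator_of_mem h2, hκ0, zero_mul] at h1
    exact h1
  · rw [dense_iff]
    intro h
    have h1 := gapStep_mem_orthogonal hT hL.le
    rw [h, Submodule.mem_bot, Lp.eq_zero_iff_ae_eq_zero] at h1
    have h2 := (memLp_gapStep T L).coeFn_toLp.symm.trans h1
    obtain ⟨t, ht, h3⟩ := exists_mem_of_ae_restrict (s := Ioo (0 : ℝ) (gcdThree T))
      measurableSet_Ioo (by simpa [Real.volume_Ioo] using (gcdThree_pos hT).ne')
      (ae_restrict_of_ae_restrict_of_subset (Ioo_subset_Ioo_right (hgT.trans hL.le)) h2)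
    simp [gapStep_first hT ht] at h3

lemma isNormalizedGenerator_gapStep (hT : ∀ i, 0 < T i) :
    IsNormalizedGenerator (periodSum T) (criticalLength T) (gapStep T) := by
  refine ⟨⟨memLp_gapStep T _, le_antisymm (fun u hu => ?_) ?_⟩, gcdThree T,
    Nat.cast_pos.2 (gcdThree_pos hT), ?_⟩
  · obtain ⟨κ, hκ⟩ := exists_ae_eq_mul_gapStep hT le_rfl hu
    rw [Submodule.mem_span_singleton]
    refine ⟨κ, Lp.ext ?_⟩
    filter_upwards [hκ, ae_restrict_mem measurableSet_Ioo, Lp.coeFn_smul κ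
      ((memLp_gapStep T (criticalLength T)).toLp _),
      (memLp_gapStep T (criticalLength T)).coeFn_toLp] with t h1 h2 h3 h4
    rw [h3, Pi.smul_apply, h4, smul_eq_mul, ← h1, indicator_of_mem h2]
  · rw [Submodule.span_singleton_le_iff_mem]
    exact gapStep_mem_orthogonal hT le_rfl
  · filter_upwards [ae_restrict_mem measurableSet_Ioo] with t ht
    rw [gapStep_first hT ht]
    exact one_pos

/-- Every normalized generator is a positive multiple of `gapStep`: the factor, a priori complex, is the
value of the generator at a generic point near `0`, where `gapStep` equals `1`. -/
lemma exists_pos_mul_gapStep (hT : ∀ i, 0 < T i) {h : ℝ → ℝ}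
    (hh : IsNormalizedGenerator (periodSum T) (criticalLength T) h) :
    ∃ k : ℝ, 0 < k ∧ ∀ᵐ t ∂volume.restrict (Ioo 0 (criticalLength T)), h t = k * gapStep T t := by
  obtain ⟨⟨hm, hspan⟩, δ, hδ, hpos⟩ := hh
  have hg : (0 : ℝ) < gcdThree T := Nat.cast_pos.2 (gcdThree_pos hT)
  have hmem : hm.toLp _ ∈ (restrictL2 (periodSum T) (criticalLength T))ᗮ := by
    rw [hspan]; exact Submodule.mem_span_singleton_self _
  obtain ⟨κ, hκ⟩ := exists_ae_eq_mul_gapStep hT le_rfl hmem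
  have hκ' : ∀ᵐ t ∂volume.restrict (Ioo 0 (criticalLength T)), (h t : ℂ) = κ * gapStep T t := by
    filter_upwards [hκ, ae_restrict_mem measurableSet_Ioo, hm.coeFn_toLp] with t h1 h2 h3
    rwa [indicator_of_mem h2, h3] at h1
  obtain ⟨t, ht, h1, h2⟩ := exists_mem_of_ae_restrict (s := Ioo 0 (min δ (gcdThree T)))
    measurableSet_Ioo (by simp [Real.volume_Ioo, hδ, (gcdThree_pos hT).ne'])
    ((ae_restrict_of_ae_restrict_of_subset (Ioo_subset_Ioo_right
      ((min_le_right _ _).trans (gcdThree_le_criticalLength hT))) hκ').and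
      (ae_restrict_of_ae_restrict_of_subset (Ioo_subset_Ioo_right (min_le_left _ _)) hpos))
  rw [gapStep_first hT ⟨ht.1, ht.2.trans_le (min_le_right _ _)⟩, Complex.ofReal_one,
    mul_one] at h1
  refine ⟨h t, h2, ?_⟩
  filter_upwards [hκ'] with s hs
  rw [← h1] at hs
  exact_mod_cast hs

/-! ### Intervals on which a normalized generator vanishes -/

lemma ae_eq_mul_coeff (hT : ∀ i, 0 < T i) {h : ℝ → ℝ} {k : ℝ}
    (hk : ∀ᵐ t ∂volume.restrict (Ioo 0 (criticalLength T)), h t = k * gapStep T t)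
    {j : ℕ} (hj : 1 ≤ j) (hjT : (j : ℝ) * gcdThree T ≤ criticalLength T) :
    ∀ᵐ t ∂volume.restrict (unitInterval3 T j), h t = k * (periodPoly T).coeff (j - 1) := by
  have hj' : (((j - 1 : ℕ) : ℝ)) = j - 1 := by rw [Nat.cast_sub hj, Nat.cast_one]
  have hsub : unitInterval3 T j ⊆ Ioo 0 (criticalLength T) := by
    refine Ioo_subset_Ioo ?_ hjT
    rw [← hj']; positivity
  filter_upwards [ae_restrict_of_ae_restrict_of_subset hsub hk,
    ae_restrict_mem (measurableSet_Ioo : MeasurableSet (unitInterval3 T j))] with t h1 h2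
  rw [h1, gapStep_of_mem hT (n := j - 1)]
  rw [hj', sub_add_cancel]
  exact Ioo_subset_Ico_self h2

lemma mul_gcdThree_le_iff (hT : ∀ i, 0 < T i) (j : ℕ) :
    (j : ℝ) * gcdThree T ≤ criticalLength T ↔ j ≤ (periodPoly T).natDegree + 1 := by
  rw [criticalLength_eq hT, mul_le_mul_iff_left₀ (Nat.cast_pos.2 (gcdThree_pos hT)), Nat.cast_le]

lemma exists_vanishing_iff (hT : ∀ i, 0 < T i) {h : ℝ → ℝ} {k : ℝ} (hk0 : 0 < k)
    (hk : ∀ᵐ t ∂volume.restrict (Ioo 0 (criticalLength T)), h t = k * gapStep T t) :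
    (∃ j : ℕ, 1 ≤ j ∧ (j : ℝ) * gcdThree T ≤ criticalLength T ∧
      ∀ᵐ t ∂volume.restrict (unitInterval3 T j), h t = 0) ↔
    ∃ i ≤ (periodPoly T).natDegree, (periodPoly T).coeff i = 0 := by
  constructor
  · rintro ⟨j, hj, hjT, h0⟩
    obtain ⟨t, -, h1, h2⟩ := exists_mem_of_ae_restrict measurableSet_Ioo
      (by simp [Real.volume_Ioo, sub_mul, (gcdThree_pos hT).ne'])
      ((ae_eq_mul_coeff hT hk hj hjT).and h0)
    rw [mul_gcdThree_le_iff hT] at hjT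
    refine ⟨j - 1, by omega, ?_⟩
    rw [h2] at h1
    exact_mod_cast (mul_eq_zero.1 h1.symm).resolve_left hk0.ne'
  · rintro ⟨i, hi, h0⟩
    have hiT : ((i + 1 : ℕ) : ℝ) * gcdThree T ≤ criticalLength T := by
      rw [mul_gcdThree_le_iff hT]; omega
    refine ⟨i + 1, by omega, hiT, ?_⟩
    filter_upwards [ae_eq_mul_coeff hT hk (by omega) hiT] with t ht
    rw [ht, Nat.add_sub_cancel, h0, Nat.cast_zero, mul_zero]

lemma gcdThree_lt_gcd_lt_min_iff (hT : ∀ i, 0 < T i) (i j : Fin 3) :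
    gcdThree T < (T i).gcd (T j) ∧ (T i).gcd (T j) < min (T i) (T j) ↔
      (T i / gcdThree T).gcd (T j / gcdThree T) ≠ 1 ∧
      (T i / gcdThree T).gcd (T j / gcdThree T) < T i / gcdThree T ∧
      (T i / gcdThree T).gcd (T j / gcdThree T) < T j / gcdThree T := by
  have hg := gcdThree_pos hT
  have hpos := Nat.gcd_pos_of_pos_left (T j / gcdThree T) (div_gcdThree_pos hT i)
  have hT' : ∀ n i, n * gcdThree T < T i ↔ n < T i / gcdThree T := fun n i => by
    conv_lhs => rw [← Nat.div_mul_cancel (gcdThree_dvd T i)]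
    exact Nat.mul_lt_mul_right hg
  rw [← gcd_div_mul T i j, lt_min_iff, hT', hT', lt_mul_iff_one_lt_left hg]
  refine and_congr_left fun _ => ?_
  omega

lemma exists_coeff_periodPoly_eq_zero_iff (hT : ∀ i, 0 < T i) :
    (∃ i ≤ (periodPoly T).natDegree, (periodPoly T).coeff i = 0) ↔
    ∀ i j : Fin 3, i ≠ j →
      gcdThree T < Nat.gcd (T i) (T j) ∧ Nat.gcd (T i) (T j) < min (T i) (T j) := by
  have h0 := div_gcdThree_pos hT 0
  have h1 := div_gcdThree_pos hT 1
  have h2 := div_gcdThree_pos hT 2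
  have hgcd := gcd_div_gcdThree hT
  simp only [gcdThree_lt_gcd_lt_min_iff hT]
  rw [periodPoly, exists_coeff_eq_zero_iff hgcd h0 h1 h2]
  generalize hA : (fun i => T i / gcdThree T) = A
  have hA' : ∀ i, T i / gcdThree T = A i := fun i => congrFun hA i
  simp only [hA'] at *
  refine ⟨fun h => ?_, fun h => ⟨(h 0 1 (by decide)).1, (h 1 2 (by decide)).1,
    (h 2 0 (by decide)).1⟩⟩
  obtain ⟨h01, h12, h20⟩ := h
  have hgcd1 := (gcd_rotate (A 0) (A 1) (A 2)).trans hgcd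
  have hgcd2 := (gcd_rotate (A 1) (A 2) (A 0)).trans hgcd1
  -- for each pair, both strict inequalities follow from the two other gcds being nontrivial
  have key : ∀ a b c : ℕ, (a.gcd b).gcd c = 1 → 0 < a → 0 < b → a.gcd b ≠ 1 → b.gcd c ≠ 1 →
      c.gcd a ≠ 1 → (a.gcd b ≠ 1 ∧ a.gcd b < a ∧ a.gcd b < b) ∧
        (b.gcd a ≠ 1 ∧ b.gcd a < b ∧ b.gcd a < a) := by
    intro a b c habc ha hb hab hbc hca
    have hlt := gcd_lt_of_ne_one (a := b) (b := a) (c := c) (by rwa [Nat.gcd_comm b a]) hb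
      (by rwa [Nat.gcd_comm])
    have hlt' := gcd_lt_of_ne_one habc ha hca
    rw [Nat.gcd_comm b a] at *
    exact ⟨⟨hab, hlt', hlt⟩, hab, hlt, hlt'⟩
  have k01 := key _ _ _ hgcd h0 h1 h01 h12 h20
  have k12 := key _ _ _ hgcd1 h1 h2 h12 h20 h01
  have k20 := key _ _ _ hgcd2 h2 h0 h20 h01 h12
  intro i j hij
  fin_cases i <;> fin_cases j
  · exact absurd rfl hij
  · exact k01.1
  · exact k20.2
  · exact k01.2
  · exact absurd rfl hij
  · exact k12.1
  · exact k20.1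
  · exact k12.2
  · exact absurd rfl hij

end

end

end CriticalLength

end

theorem theorem1p1 (T : Fin 3 → ℕ) (hT : ∀ i, 0 < T i) :
    -- the critical length
    IsCriticalLength (periodSum T) (criticalLength T) ∧
    -- existence of the normalized function at the critical length
    (∃ h : ℝ → ℝ, IsNormalizedGenerator (periodSum T) (criticalLength T) h) ∧
    ∀ h : ℝ → ℝ, IsNormalizedGenerator (periodSum T) (criticalLength T) h →
      -- it is constant on each unit interval
      (∀ j : ℕ, 1 ≤ j → (j : ℝ) * gcdThree T ≤ criticalLength T →
        ∃ c : ℝ, ∀ᵐ t ∂volume.restrict (unitInterval3 T j), h t = c) ∧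
      -- it is nonnegative
      (∀ᵐ t ∂volume.restrict (Ioo (0 : ℝ) (criticalLength T)), 0 ≤ h t) ∧
      -- it vanishes on a unit interval exactly under the arithmetic condition
      ((∃ j : ℕ, 1 ≤ j ∧ (j : ℝ) * gcdThree T ≤ criticalLength T ∧
          ∀ᵐ t ∂volume.restrict (unitInterval3 T j), h t = 0) ↔
        ∀ i j : Fin 3, i ≠ j →
          gcdThree T < Nat.gcd (T i) (T j) ∧ Nat.gcd (T i) (T j) < min (T i) (T j)) := by
  refine ⟨CriticalLength.isCriticalLength_periodSum hT,
    ⟨_, CriticalLength.isNormalizedGenerator_gapStep hT⟩, fun h hh => ?_⟩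
  obtain ⟨k, hk0, hk⟩ := CriticalLength.exists_pos_mul_gapStep hT hh
  refine ⟨fun j hj hjT => ⟨_, CriticalLength.ae_eq_mul_coeff hT hk hj hjT⟩, ?_,
    (CriticalLength.exists_vanishing_iff hT hk0 hk).trans
      (CriticalLength.exists_coeff_periodPoly_eq_zero_iff hT)⟩
  filter_upwards [hk] with t ht
  rw [ht]
  exact mul_nonneg hk0.le (CriticalLength.gapStep_nonneg T t)
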